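/- Let $\sigma_U,\sigma_A>0$ and $t_U>0$, and let $(U,A)$ be the nested Gaussian process of orders $m=2$, $n=1$ on $\mathcal T=[0,t_U]$, i.e. the solution of the stochastic differential equations $$D^2U(t)=A(t)+\sigma_U\dot W_U(t),\qquad D^1A(t)=\sigma_A\dot W_A(t),$$ where $\dot W_U,\dot W_A$ are Gaussian white noises (the formal derivatives of standard Wiener processes $W_U,W_A$). That is, almost surely $U\in C^1[0,t_U]$, $A$ is continuous on $[0,t_U]$, and for all $t\in[0,t_U]$ $$D^1U(t)=D^1U(0)+\int_0^tA(s)\,ds+\sigma_UW_U(t),\qquad A(t)=A(0)+\sigma_AW_A(t).$$ The initial values satisfy $\mu=(U(0),D^1U(0))'\sim N_2(0,\sigma_\mu^2I)$ and $\alpha=A(0)\sim N_1(0,\sigma_\alpha^2)$, and $\mu,\alpha,W_U,W_A$ are mutually independent. Let $0=t_0<t_1<\dots<t_J<t_U$ be design points, $\delta_j=t_{j+1}-t_j$, and $\theta_j=\{U(t_j),D^1U(t_j),A(t_j)\}'$. Then the $\theta_j$ follow the linear Gaussian state equation $$\theta_{j+1}=G_j\theta_j+\omega_j,\qquad \omega_j\sim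 N_3(0,W_j),\qquad j=0,\dots,J-1,$$ where for each $j$ the disturbance $\omega_j$ is independent of $(\theta_0,\dots,\theta_j)$, $$G_j=\begin{pmatrix}1&\delta_j&\frac{\delta_j^2}{2}\\0&1&\delta_j\\0&0&1\end{pmatrix},\qquad W_j=\begin{pmatrix}\frac{\delta_j^3}{3}\sigma_U^2+\frac{\delta_j^5}{20}\sigma_A^2&\frac{\delta_j^2}{2}\sigma_U^2+\frac{\delta_j^4}{8}\sigma_A^2&\frac{\delta_j^3}{6}\sigma_A^2\\ \frac{\delta_j^2}{2}\sigma_U^2+\frac{\delta_j^4}{8}\sigma_A^2&\delta_j\sigma_U^2+\frac{\delta_j^3}{3}\sigma_A^2&\frac{\delta_j^2}{2}\sigma_A^2\\ \frac{\delta_j^3}{6}\sigma_A^2&\frac{\delta_j^2}{2}\sigma_A^2&\delta_j\sigma_A^2\end{pmatrix},$$ and $W_j$ is a positive semidefinite matrix. -/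

import Mathlib

open MeasureTheory ProbabilityTheory Set
open scoped NNReal Matrix

noncomputable section

namespace NestedGP

variable {Ω : Type*} [MeasurableSpace Ω]

/-- The vector `(X(0), D¹X(0), …, D^{k-1}X(0))` of initial values of a process `X` on the time
interval `[0, T]` (derivatives at `0` are one-sided). -/
def initialValues (k : ℕ) (T : ℝ) (X : ℝ → Ω → ℝ) (x : Ω) : EuclideanSpace ℝ (Fin k) :=
  WithLp.toLp 2 fun i : Fin k => iteratedDerivWithin (i : ℕ) (fun s => X s x) (Icc 0 T) 0

/-- `(U, A)` is a nested Gaussian process of orders `m`, `n` on `[0, T]` under `P`, driven by the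
Wiener processes `WU`, `WA`: it solves
`D^m U(t) = A(t) + σU dWU(t)/dt` and `D^n A(t) = σA dWA(t)/dt`,
where `dWU/dt`, `dWA/dt` are independent Gaussian white noises, with independent centred Gaussian
initial values. As usual a stochastic differential equation is read in its
integrated form, and holds along almost every path. -/
structure IsNestedGP (m n : ℕ) (T σU σA σμ σα : ℝ) (U A : ℝ → Ω → ℝ)
    (WU WA : ℝ≥0 → Ω → ℝ) (P : Measure Ω) : Prop where
  two_le_m : 2 ≤ m
  one_le_n : 1 ≤ n
  brownian_U : IsBrownianReal WU P
  brownian_A : IsBrownianReal WA P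
  /-- `U` has `m - 1` continuous derivatives. -/
  smooth_U : ∀ᵐ x ∂P, ContDiffOn ℝ ((m - 1 : ℕ) : WithTop ℕ∞) (fun s => U s x) (Icc 0 T)
  /-- `A` has `n - 1` continuous derivatives. -/
  smooth_A : ∀ᵐ x ∂P, ContDiffOn ℝ ((n - 1 : ℕ) : WithTop ℕ∞) (fun s => A s x) (Icc 0 T)
  /-- `D^m U(t) = A(t) + σU dWU(t)/dt`. -/
  sde_U : ∀ᵐ x ∂P, ∀ t ∈ Icc 0 T,
    iteratedDerivWithin (m - 1) (fun s => U s x) (Icc 0 T) t =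
      iteratedDerivWithin (m - 1) (fun s => U s x) (Icc 0 T) 0
        + (∫ s in (0 : ℝ)..t, A s x) + σU * WU t.toNNReal x
  /-- `D^n A(t) = σA dWA(t)/dt`. -/
  sde_A : ∀ᵐ x ∂P, ∀ t ∈ Icc 0 T,
    iteratedDerivWithin (n - 1) (fun s => A s x) (Icc 0 T) t =
      iteratedDerivWithin (n - 1) (fun s => A s x) (Icc 0 T) 0 + σA * WA t.toNNReal x
  /-- `μ = (U(0), …, D^{m-1}U(0)) ∼ N_m(0, σμ² I)`. -/
  law_μ : HasLaw (initialValues m T U)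
    (multivariateGaussian 0 (σμ ^ 2 • (1 : Matrix (Fin m) (Fin m) ℝ))) P
  /-- `α = (A(0), …, D^{n-1}A(0)) ∼ N_n(0, σα² I)`. -/
  law_α : HasLaw (initialValues n T A)
    (multivariateGaussian 0 (σα ^ 2 • (1 : Matrix (Fin n) (Fin n) ℝ))) P
  /-- `μ`, `α`, `WU` and `WA` are mutually independent. -/
  indep : iIndep ![
    MeasurableSpace.comap (initialValues m T U) inferInstance,
    MeasurableSpace.comap (initialValues n T A) inferInstance,
    MeasurableSpace.comap (fun x (s : ℝ≥0) => WU s x) inferInstance,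
    MeasurableSpace.comap (fun x (s : ℝ≥0) => WA s x) inferInstance] P

/-- The state vector `θ(t) = (U(t), D¹U(t), A(t))'`. -/
def state (T : ℝ) (U A : ℝ → Ω → ℝ) (t : ℝ) (x : Ω) : EuclideanSpace ℝ (Fin 3) :=
  !₂[U t x, derivWithin (fun s => U s x) (Icc 0 T) t, A t x]

/-- The transition matrix over a time step of length `δ`. -/
def transition (δ : ℝ) : Matrix (Fin 3) (Fin 3) ℝ :=
  !![1, δ, δ ^ 2 / 2;
     0, 1, δ;
     0, 0, 1]

/-- The covariance matrix of the state disturbance over a time step of length `δ`. -/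
def noiseCov (σU σA δ : ℝ) : Matrix (Fin 3) (Fin 3) ℝ :=
  !![δ ^ 3 / 3 * σU ^ 2 + δ ^ 5 / 20 * σA ^ 2,
       δ ^ 2 / 2 * σU ^ 2 + δ ^ 4 / 8 * σA ^ 2, δ ^ 3 / 6 * σA ^ 2;
     δ ^ 2 / 2 * σU ^ 2 + δ ^ 4 / 8 * σA ^ 2,
       δ * σU ^ 2 + δ ^ 3 / 3 * σA ^ 2, δ ^ 2 / 2 * σA ^ 2;
     δ ^ 3 / 6 * σA ^ 2, δ ^ 2 / 2 * σA ^ 2, δ * σA ^ 2]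

end NestedGP

end

noncomputable section

namespace NestedGP

open Filter Topology

/-! Over a step `[s, s + δ]`, integrating the equations along each path and then by parts gives the
state equation with disturbance `stateNoise` applied to the increments of the Wiener paths after `s`
(`eq_transition_add_stateNoise`).

Law: pairing the disturbance with a vector `y` gives `σU ∫ G_U dW_U + σA ∫ G_A dW_A`, where `G_U(u)
= y₁ + y₀(δ - u)` and `G_A(u) = y₂ + y₁(δ - u) + y₀(δ - u)²/2`. These Wiener integrals are
independent centred Gaussians (`hasLaw_wienerIntegral`), and the total variance is the quadratic
form of `noiseCov` at `y` (`dotProduct_noiseCov`). Characteristic functions then identify the joint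
law; the same formula gives positive semidefiniteness.

Independence: the states up to time `s` are almost surely measurable functions of the initial values
and of the paths up to `s` (`exists_measurable_state`), and these are independent of the later
increments (`indepFun_shift_of_iIndep`). -/

/-! ### Riemann sums on uniform grids. -/

/-- The `k`-th point of the partition of `[0, δ]` into `N` intervals of equal length. -/
def gridPoint (δ : ℝ) (N k : ℕ) : ℝ := δ * k / N

lemma gridPoint_zero (δ : ℝ) (N : ℕ) : gridPoint δ N 0 = 0 := by simp [gridPoint]

lemma gridPoint_self (δ : ℝ) {N : ℕ} (hN : N ≠ 0) : gridPoint δ N N = δ := by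
  have : (N : ℝ) ≠ 0 := by exact_mod_cast hN
  simp [gridPoint, this]

lemma gridPoint_succ_sub (δ : ℝ) (N k : ℕ) :
    gridPoint δ N (k + 1) - gridPoint δ N k = δ / N := by
  simp only [gridPoint]; push_cast; ring

lemma monotone_gridPoint {δ : ℝ} (hδ : 0 ≤ δ) (N : ℕ) : Monotone (gridPoint δ N) := by
  intro i j hij
  have : (i : ℝ) ≤ j := by exact_mod_cast hij
  unfold gridPoint
  gcongr

lemma gridPoint_nonneg {δ : ℝ} (hδ : 0 ≤ δ) (N k : ℕ) : 0 ≤ gridPoint δ N k := by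
  unfold gridPoint; positivity

lemma gridPoint_le {δ : ℝ} (hδ : 0 ≤ δ) {N k : ℕ} (hk : k ≤ N) : gridPoint δ N k ≤ δ := by
  rcases Nat.eq_zero_or_pos N with rfl | hN
  · simpa [gridPoint] using hδ
  · exact (monotone_gridPoint hδ N hk).trans (gridPoint_self δ hN.ne').le

/-- Riemann sums of a product of two continuous functions, with one factor integrated exactly over
each interval of the partition and the other one evaluated at a point of the interval. -/
lemma tendsto_sum_integral_mul {δ : ℝ} (hδ : 0 ≤ δ) {h f : ℝ → ℝ} (hh : Continuous h)
    (hf : Continuous f) (c : ℕ → ℕ → ℝ)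
    (hc : ∀ N k, c N k ∈ Icc (gridPoint δ N k) (gridPoint δ N (k + 1))) :
    Tendsto (fun N => ∑ k ∈ Finset.range N,
        (∫ u in gridPoint δ N k..gridPoint δ N (k + 1), h u) * f (c N k)) atTop
      (𝓝 (∫ u in (0 : ℝ)..δ, h u * f u)) := by
  obtain ⟨M, hM⟩ := isCompact_Icc.exists_bound_of_continuousOn (s := Icc 0 δ) hh.continuousOn
  have hM0 : 0 ≤ M := (norm_nonneg _).trans (hM 0 ⟨le_rfl, hδ⟩)
  have huc := Metric.uniformContinuousOn_iff.1
    (isCompact_Icc.uniformContinuousOn_of_continuous (s := Icc 0 δ) hf.continuousOn)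
  rw [Metric.tendsto_atTop]
  intro ε hε
  -- The `+ 1` keeps the denominator positive when `M * δ = 0` and makes the final bound strict.
  set e := ε / (M * δ + 1) with he
  have hMδ : 0 < M * δ + 1 := by positivity
  have he0 : 0 < e := by positivity
  obtain ⟨η, hη, H⟩ := huc e he0
  obtain ⟨N₀, hN₀⟩ := exists_nat_gt (δ / η)
  refine ⟨N₀ + 1, fun N hN => ?_⟩
  have hNpos : 0 < N := by omega
  have hNr : (0 : ℝ) < N := by exact_mod_cast hNpos
  have hmesh : δ / N < η := by
    rw [div_lt_iff₀ hNr]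
    have : (N₀ : ℝ) ≤ N := by exact_mod_cast (by omega : N₀ ≤ N)
    have := hN₀.trans_le this
    rw [div_lt_iff₀ hη] at this
    linarith
  have hint : ∀ a b, IntervalIntegrable (fun u => h u * f u) volume a b :=
    fun a b => (hh.mul hf).intervalIntegrable a b
  have hsplit : (∫ u in (0 : ℝ)..δ, h u * f u)
      = ∑ k ∈ Finset.range N, ∫ u in gridPoint δ N k..gridPoint δ N (k + 1), h u * f u := by
    rw [intervalIntegral.sum_integral_adjacent_intervals fun k _ => hint _ _, gridPoint_zero,
      gridPoint_self δ hNpos.ne']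
  rw [dist_eq_norm, hsplit, ← Finset.sum_sub_distrib]
  have hterm : ∀ k ∈ Finset.range N,
      ‖(∫ u in gridPoint δ N k..gridPoint δ N (k + 1), h u) * f (c N k)
        - ∫ u in gridPoint δ N k..gridPoint δ N (k + 1), h u * f u‖ ≤ M * e * (δ / N) := by
    intro k hk
    have hk := Finset.mem_range.1 hk
    rw [← intervalIntegral.integral_mul_const, ← intervalIntegral.integral_sub
      ((by fun_prop : Continuous fun u => h u * f (c N k)).intervalIntegrable _ _) (hint _ _)]
    have hle := monotone_gridPoint hδ N (Nat.le_succ k)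
    have := intervalIntegral.norm_integral_le_of_norm_le_const (a := gridPoint δ N k)
      (b := gridPoint δ N (k + 1)) (C := M * e) (f := fun u => h u * f (c N k) - h u * f u) ?_
    · rwa [gridPoint_succ_sub, abs_of_nonneg (by positivity)] at this
    · intro u hu
      rw [uIoc_of_le hle] at hu
      have h0 := gridPoint_nonneg hδ N k
      have h1 := gridPoint_le hδ (N := N) (k := k + 1) hk
      have hu' : u ∈ Icc 0 δ := ⟨h0.trans hu.1.le, hu.2.trans h1⟩
      have hc' : c N k ∈ Icc 0 δ := ⟨h0.trans (hc N k).1, (hc N k).2.trans h1⟩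
      have hd : dist (c N k) u < η := by
        have h2 := gridPoint_succ_sub δ N k
        have h3 := hc N k
        rw [Real.dist_eq, abs_lt]
        constructor <;> linarith [h3.1, h3.2, hu.1, hu.2]
      rw [← mul_sub, norm_mul]
      have h4 := (H _ hc' _ hu' hd).le
      rw [dist_eq_norm] at h4
      exact mul_le_mul (hM u hu') h4 (norm_nonneg _) hM0
  calc _ ≤ ∑ k ∈ Finset.range N, M * e * (δ / N) := norm_sum_le_of_le _ hterm
    _ = M * δ * e := by
      rw [Finset.sum_const, Finset.card_range, nsmul_eq_mul]; field_simp
    _ < (M * δ + 1) * e := by linarith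
    _ = ε := by rw [he]; field_simp

/-! ### Gaussian limits and Wiener integrals. -/

/-- An almost sure limit of centred Gaussian variables is centred Gaussian, if the variances
converge. -/
lemma hasLaw_gaussianReal_of_tendsto {Ω : Type*} [MeasurableSpace Ω] {P : Measure Ω}
    [IsProbabilityMeasure P] {X : ℕ → Ω → ℝ} {Y : Ω → ℝ} {v : ℕ → ℝ≥0} {w : ℝ≥0}
    (hX : ∀ n, HasLaw (X n) (gaussianReal 0 (v n)) P) (hv : Tendsto v atTop (𝓝 w))
    (hY : ∀ᵐ x ∂P, Tendsto (fun n => X n x) atTop (𝓝 (Y x))) :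
    HasLaw Y (gaussianReal 0 w) P := by
  have hYm : AEMeasurable Y P := aemeasurable_of_tendsto_metrizable_ae atTop
    (fun n => (hX n).aemeasurable) hY
  refine ⟨hYm, ?_⟩
  have := Measure.isProbabilityMeasure_map hYm
  refine Measure.ext_of_charFun ?_
  ext s
  rw [charFun_apply_real, integral_map hYm (by fun_prop)]
  have h1 : Tendsto (fun n => ∫ x, Complex.exp (s * X n x * Complex.I) ∂P) atTop
      (𝓝 (∫ x, Complex.exp (s * Y x * Complex.I) ∂P)) := by
    refine tendsto_integral_of_dominated_convergence (fun _ => 1) (fun n => ?_)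
      (integrable_const _) (fun n => .of_forall fun x => ?_) ?_
    · have := (hX n).aemeasurable
      have : AEMeasurable (fun x => Complex.exp (s * X n x * Complex.I)) P := by fun_prop
      exact this.aestronglyMeasurable
    · have := Complex.norm_exp_ofReal_mul_I (s * X n x)
      push_cast at this
      exact this.le
    · filter_upwards [hY] with x hx
      have hcont : Continuous fun y : ℝ => Complex.exp (s * y * Complex.I) := by fun_prop
      exact (hcont.tendsto _).comp hx
  have h2 : ∀ n, ∫ x, Complex.exp (s * X n x * Complex.I) ∂P
      = charFun (gaussianReal 0 (v n)) s := fun n => by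
    rw [← (hX n).map_eq, charFun_apply_real, integral_map (hX n).aemeasurable (by fun_prop)]
  simp_rw [h2, charFun_gaussianReal] at h1
  refine tendsto_nhds_unique h1 ?_
  rw [charFun_gaussianReal]
  have hcont : Continuous fun r : ℝ≥0 =>
      Complex.exp (s * (0 : ℝ) * Complex.I - ((r : ℝ) : ℂ) * s ^ 2 / 2) := by fun_prop
  exact (hcont.tendsto w).comp hv

lemma hasLaw_gaussianReal_sum {Ω : Type*} [MeasurableSpace Ω] {P : Measure Ω}
    [IsProbabilityMeasure P] {X : ℕ → Ω → ℝ} {v : ℕ → ℝ≥0}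
    (hX : ∀ n, HasLaw (X n) (gaussianReal 0 (v n)) P) (hi : iIndepFun X P) (N : ℕ) :
    HasLaw (∑ k ∈ Finset.range N, X k) (gaussianReal 0 (∑ k ∈ Finset.range N, v k)) P := by
  induction N with
  | zero =>
    simp only [Finset.range_zero, Finset.sum_empty, gaussianReal_zero_var]
    exact hasLaw_dirac_of_ae_eq (by rfl)
  | succ N ih =>
    rw [Finset.sum_range_succ, Finset.sum_range_succ]
    have h := hi.indepFun_finsetSum_of_notMem₀ (fun i => (hX i).aemeasurable)
      (Finset.notMem_range_self (n := N))
    exact ⟨ih.aemeasurable.add (hX N).aemeasurable, by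
      simpa using gaussianReal_add_gaussianReal_of_indepFun h ih.map_eq (hX N).map_eq⟩

/-- Abel summation, the discrete form of `∫ G dB = G B - ∫ g B`. It samples `f` at right endpoints.
-/
lemma sum_mul_sub_by_parts (G f : ℕ → ℝ) (N : ℕ) :
    ∑ k ∈ Finset.range N, G k * (f (k + 1) - f k)
      = G N * f N - G 0 * f 0 - ∑ k ∈ Finset.range N, (G (k + 1) - G k) * f (k + 1) := by
  induction N with
  | zero => simp
  | succ N ih => rw [Finset.sum_range_succ, Finset.sum_range_succ, ih]; ring

lemma continuous_comp_toNNReal {f : ℝ≥0 → ℝ} (hf : Continuous f) :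
    Continuous fun u : ℝ => f u.toNNReal := hf.comp continuous_real_toNNReal

/-- The Wiener integral `∫ G dB` over `[0, δ]` of a continuously differentiable function `G`,
written through integration by parts, has law `N(0, ∫ G²)`. -/
lemma hasLaw_wienerIntegral {Ω : Type*} [MeasurableSpace Ω] {P : Measure Ω}
    [IsProbabilityMeasure P] {B : ℝ≥0 → Ω → ℝ} (hB : IsBrownianReal B P) {δ : ℝ} (hδ : 0 ≤ δ)
    {G g : ℝ → ℝ} (hG : ∀ u, HasDerivAt G (g u) u) (hg : Continuous g) :
    HasLaw (fun x => G δ * B δ.toNNReal x - ∫ u in (0 : ℝ)..δ, g u * B u.toNNReal x)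
      (gaussianReal 0 (∫ u in (0 : ℝ)..δ, G u ^ 2).toNNReal) P := by
  have hGc : Continuous G := continuous_iff_continuousAt.2 fun u => (hG u).continuousAt
  let τ (N k : ℕ) : ℝ≥0 := (gridPoint δ N k).toNNReal
  let v (N k : ℕ) : ℝ≥0 := NNReal.mk (G (gridPoint δ N k) ^ 2) (sq_nonneg _) * (δ / N).toNNReal
  let S (N : ℕ) : Ω → ℝ := ∑ k ∈ Finset.range N,
    fun x => G (gridPoint δ N k) * (B (τ N (k + 1)) x - B (τ N k) x)
  have hτ : ∀ N, Monotone (τ N) := fun N _ _ hij =>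
    Real.toNNReal_mono (monotone_gridPoint hδ N hij)
  have hS : ∀ N, HasLaw (S N) (gaussianReal 0 (∑ k ∈ Finset.range N, v N k)) P := by
    intro N
    refine hasLaw_gaussianReal_sum (X := fun k x =>
      G (gridPoint δ N k) * (B (τ N (k + 1)) x - B (τ N k) x)) (fun k => ?_) ?_ N
    · have h1 := hB.hasLaw_sub (τ N (k + 1)) (τ N k)
      have h2 : nndist (τ N (k + 1)).1 (τ N k).1 = (δ / N).toNNReal := by
        rw [← NNReal.coe_inj, coe_nndist, Real.coe_toNNReal _ (by positivity), Real.dist_eq]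
        simp only [τ, NNReal.val_eq_coe]
        rw [Real.coe_toNNReal _ (gridPoint_nonneg hδ _ _),
          Real.coe_toNNReal _ (gridPoint_nonneg hδ _ _), gridPoint_succ_sub,
          abs_of_nonneg (by positivity)]
      rw [h2] at h1
      simpa [v] using gaussianReal_const_mul h1 (G (gridPoint δ N k))
    · exact (hB.hasIndepIncrements.nat (hτ N)).comp (fun k y => G (gridPoint δ N k) * y)
        (fun k => by fun_prop)
  refine hasLaw_gaussianReal_of_tendsto hS ?_ ?_
  -- The variances of the sums `S N` are the left Riemann sums of `∫ G²`.
  · have h := tendsto_sum_integral_mul hδ (h := fun _ => 1) continuous_const (hGc.pow 2)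
      (fun N k => gridPoint δ N k) (fun N k => ⟨le_rfl, monotone_gridPoint hδ N k.le_succ⟩)
    have h' := (continuous_real_toNNReal.tendsto _).comp h
    simp only [one_mul] at h'
    refine h'.congr fun N => ?_
    simp only [Function.comp_def]
    rw [Real.toNNReal_sum_of_nonneg fun k _ => ?_]
    · refine Finset.sum_congr rfl fun k _ => ?_
      rw [← NNReal.coe_inj]
      simp only [intervalIntegral.integral_const, gridPoint_succ_sub, smul_eq_mul, mul_one, v,
        NNReal.coe_mul, NNReal.coe_mk, Pi.pow_apply]
      rw [Real.coe_toNNReal _ (by positivity), Real.coe_toNNReal _ (by positivity), mul_comm]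
    · simp only [intervalIntegral.integral_const, gridPoint_succ_sub, smul_eq_mul, mul_one]
      have := sq_nonneg (G (gridPoint δ N k))
      exact mul_nonneg (by positivity) this
  · filter_upwards [hB.cont, hB.eval_zero_ae_eq_zero] with x hx h0
    have h := tendsto_sum_integral_mul hδ hg (continuous_comp_toNNReal hx)
      (fun N k => gridPoint δ N (k + 1)) (fun N k => ⟨monotone_gridPoint hδ N k.le_succ, le_rfl⟩)
    refine (h.const_sub (G δ * B δ.toNNReal x)).congr' ?_
    -- For `N = 0` division by zero puts every grid point at `0`, so the last one need not be `δ`.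
    filter_upwards [eventually_ne_atTop 0] with N hN
    have hparts := sum_mul_sub_by_parts (fun k => G (gridPoint δ N k)) (fun k => B (τ N k) x) N
    simp only [S, Finset.sum_apply]
    rw [hparts]
    simp only [τ, gridPoint_self δ hN, gridPoint_zero, Real.toNNReal_zero, h0, mul_zero, sub_zero]
    congr 1
    refine Finset.sum_congr rfl fun k _ => ?_
    rw [intervalIntegral.integral_eq_sub_of_hasDerivAt (fun u _ => hG u)
      (hg.intervalIntegrable _ _)]

/-! ### The disturbance as a functional of the driving paths. -/

/-- The integral of a continuous path against a continuous weight is a measurable function of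
the path. -/
lemma exists_measurable_integral {δ : ℝ} (hδ : 0 ≤ δ) {h : ℝ → ℝ} (hh : Continuous h) :
    ∃ F : (ℝ≥0 → ℝ) → ℝ, Measurable F ∧ ∀ f : ℝ≥0 → ℝ, Continuous f →
      F f = ∫ u in (0 : ℝ)..δ, h u * f u.toNNReal := by
  -- Each Riemann sum uses finitely many coordinates of the path, so the `limsup` is measurable on
  -- the whole product space; its value matters only on continuous paths.
  refine ⟨fun f => limsup (fun N => ∑ k ∈ Finset.range N,
    (∫ u in gridPoint δ N k..gridPoint δ N (k + 1), h u) * f (gridPoint δ N k).toNNReal) atTop,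
    .limsup fun N => ?_, fun f hf => ?_⟩
  · fun_prop
  · exact (tendsto_sum_integral_mul hδ hh (continuous_comp_toNNReal hf)
      (fun N k => gridPoint δ N k)
      (fun N k => ⟨le_rfl, monotone_gridPoint hδ N k.le_succ⟩)).limsup_eq

/-- The disturbance of the state over a time step of length `δ`, as a function of the increments
`bU`, `bA` of the two driving paths since the start of the step. -/
def stateNoise (σU σA δ : ℝ) (bU bA : ℝ≥0 → ℝ) : EuclideanSpace ℝ (Fin 3) :=
  !₂[σU * (∫ u in (0 : ℝ)..δ, bU u.toNNReal) + σA * ∫ u in (0 : ℝ)..δ, (δ - u) * bA u.toNNReal,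
    σU * bU δ.toNNReal + σA * ∫ u in (0 : ℝ)..δ, bA u.toNNReal,
    σA * bA δ.toNNReal]

lemma exists_measurable_stateNoise (σU σA : ℝ) {δ : ℝ} (hδ : 0 ≤ δ) :
    ∃ F : (ℝ≥0 → ℝ) × (ℝ≥0 → ℝ) → EuclideanSpace ℝ (Fin 3), Measurable F ∧
      ∀ bU bA : ℝ≥0 → ℝ, Continuous bU → Continuous bA →
        F (bU, bA) = stateNoise σU σA δ bU bA := by
  obtain ⟨F₀, hF₀, h₀⟩ := exists_measurable_integral hδ (h := fun _ => 1) continuous_const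
  obtain ⟨F₁, hF₁, h₁⟩ := exists_measurable_integral hδ (h := fun u => δ - u) (by fun_prop)
  refine ⟨fun b => !₂[σU * F₀ b.1 + σA * F₁ b.2, σU * b.1 δ.toNNReal + σA * F₀ b.2,
    σA * b.2 δ.toNNReal], ?_, fun bU bA hU hA => ?_⟩
  · refine (WithLp.measurable_toLp 2 _).comp (measurable_pi_lambda _ fun i => ?_)
    fin_cases i
    · exact ((hF₀.comp measurable_fst).const_mul _).add ((hF₁.comp measurable_snd).const_mul _)
    · exact (((measurable_pi_apply _).comp measurable_fst).const_mul _).add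
        ((hF₀.comp measurable_snd).const_mul _)
    · exact ((measurable_pi_apply _).comp measurable_snd).const_mul _
  · simp [stateNoise, h₀ bU hU, h₀ bA hA, h₁ bA hA]

/-- Allows a path to be replaced by its stopped version in `exists_measurable_state`. -/
lemma stateNoise_congr {σU σA δ : ℝ} (hδ : 0 ≤ δ) {bU bU' bA bA' : ℝ≥0 → ℝ}
    (hU : ∀ u ≤ δ.toNNReal, bU u = bU' u) (hA : ∀ u ≤ δ.toNNReal, bA u = bA' u) :
    stateNoise σU σA δ bU bA = stateNoise σU σA δ bU' bA' := by
  have hle : ∀ u ∈ uIcc 0 δ, u.toNNReal ≤ δ.toNNReal := fun u hu => by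
    rw [uIcc_of_le hδ] at hu
    exact Real.toNNReal_le_toNNReal hu.2
  have h0 : ∀ {b b' : ℝ≥0 → ℝ}, (∀ u ≤ δ.toNNReal, b u = b' u) → ∀ h : ℝ → ℝ,
      (∫ u in (0 : ℝ)..δ, h u * b u.toNNReal) = ∫ u in (0 : ℝ)..δ, h u * b' u.toNNReal :=
    fun hb h => intervalIntegral.integral_congr fun u hu => by simp only [hb _ (hle u hu)]
  have hU1 := h0 hU 1
  have hA1 := h0 hA 1
  simp only [Pi.one_apply, one_mul] at hU1 hA1
  unfold stateNoise
  rw [hU _ le_rfl, hA _ le_rfl, hU1, hA1, h0 hA]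

/-! ### Gaussian law and covariance of the disturbance. -/

/-- The terms `δ - δ` are kept so that the brackets read `G δ * B δ - ∫ g B`, as in
`hasLaw_wienerIntegral`. -/
lemma inner_stateNoise (σU σA δ : ℝ) (y : EuclideanSpace ℝ (Fin 3)) {bU bA : ℝ≥0 → ℝ}
    (hA : Continuous bA) :
    inner ℝ y (stateNoise σU σA δ bU bA) =
      σU * ((y 1 + y 0 * (δ - δ)) * bU δ.toNNReal - ∫ u in (0 : ℝ)..δ, -y 0 * bU u.toNNReal)
      + σA * ((y 2 + y 1 * (δ - δ) + y 0 * (δ - δ) ^ 2 / 2) * bA δ.toNNReal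
        - ∫ u in (0 : ℝ)..δ, (-y 1 - y 0 * (δ - u)) * bA u.toNNReal) := by
  have hA' := continuous_comp_toNNReal hA
  have h : (∫ u in (0 : ℝ)..δ, (-y 1 - y 0 * (δ - u)) * bA u.toNNReal)
      = -y 1 * (∫ u in (0 : ℝ)..δ, bA u.toNNReal)
        - y 0 * ∫ u in (0 : ℝ)..δ, (δ - u) * bA u.toNNReal := by
    have i1 : Continuous fun u : ℝ => -y 1 * bA u.toNNReal := by fun_prop
    have i2 : Continuous fun u : ℝ => y 0 * ((δ - u) * bA u.toNNReal) := by fun_prop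
    rw [← intervalIntegral.integral_const_mul, ← intervalIntegral.integral_const_mul,
      ← intervalIntegral.integral_sub (i1.intervalIntegrable _ _) (i2.intervalIntegrable _ _)]
    congr 1; ext u; ring
  rw [h, intervalIntegral.integral_const_mul]
  simp only [stateNoise, PiLp.inner_apply, Fin.sum_univ_three, RCLike.inner_apply, conj_trivial]
  simp
  ring

/-- The Itô isometry in closed form: after substituting `w = δ - u`, both integrands are polynomials
with explicit primitives. -/
lemma dotProduct_noiseCov (σU σA δ : ℝ) (y : Fin 3 → ℝ) :
    y ⬝ᵥ noiseCov σU σA δ *ᵥ y =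
      σU ^ 2 * (∫ u in (0 : ℝ)..δ, (y 1 + y 0 * (δ - u)) ^ 2)
      + σA ^ 2 * ∫ u in (0 : ℝ)..δ, (y 2 + y 1 * (δ - u) + y 0 * (δ - u) ^ 2 / 2) ^ 2 := by
  have h1 : (∫ u in (0 : ℝ)..δ, (y 1 + y 0 * (δ - u)) ^ 2)
      = y 1 ^ 2 * δ + y 0 * y 1 * δ ^ 2 + y 0 ^ 2 * δ ^ 3 / 3 := by
    rw [intervalIntegral.integral_comp_sub_left (fun w => (y 1 + y 0 * w) ^ 2),
      intervalIntegral.integral_eq_sub_of_hasDerivAt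
        (f := fun w => y 1 ^ 2 * w + y 0 * y 1 * w ^ 2 + y 0 ^ 2 * w ^ 3 / 3)]
    · ring
    · intro w _
      refine ((((hasDerivAt_id' w).const_mul (y 1 ^ 2)).add
        ((hasDerivAt_pow 2 w).const_mul (y 0 * y 1))).add
        (((hasDerivAt_pow 3 w).const_mul (y 0 ^ 2)).div_const 3)).congr_deriv ?_
      simp; ring
    · exact (by fun_prop : Continuous fun w => (y 1 + y 0 * w) ^ 2).intervalIntegrable _ _
  have h2 : (∫ u in (0 : ℝ)..δ, (y 2 + y 1 * (δ - u) + y 0 * (δ - u) ^ 2 / 2) ^ 2)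
      = y 2 ^ 2 * δ + y 1 * y 2 * δ ^ 2 + (y 1 ^ 2 + y 0 * y 2) * δ ^ 3 / 3
        + y 0 * y 1 * δ ^ 4 / 4 + y 0 ^ 2 * δ ^ 5 / 20 := by
    rw [intervalIntegral.integral_comp_sub_left (fun w => (y 2 + y 1 * w + y 0 * w ^ 2 / 2) ^ 2),
      intervalIntegral.integral_eq_sub_of_hasDerivAt
        (f := fun w => y 2 ^ 2 * w + y 1 * y 2 * w ^ 2 + (y 1 ^ 2 + y 0 * y 2) * w ^ 3 / 3
          + y 0 * y 1 * w ^ 4 / 4 + y 0 ^ 2 * w ^ 5 / 20)]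
    · ring
    · intro w _
      refine ((((((hasDerivAt_id' w).const_mul (y 2 ^ 2)).add
        ((hasDerivAt_pow 2 w).const_mul (y 1 * y 2))).add
        (((hasDerivAt_pow 3 w).const_mul (y 1 ^ 2 + y 0 * y 2)).div_const 3)).add
        (((hasDerivAt_pow 4 w).const_mul (y 0 * y 1)).div_const 4)).add
        (((hasDerivAt_pow 5 w).const_mul (y 0 ^ 2)).div_const 20)).congr_deriv ?_
      simp; ring
    · exact (by fun_prop :
        Continuous fun w => (y 2 + y 1 * w + y 0 * w ^ 2 / 2) ^ 2).intervalIntegrable _ _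
  rw [h1, h2]
  simp [noiseCov, Matrix.mulVec, dotProduct, Fin.sum_univ_three]
  ring

lemma posSemidef_noiseCov (σU σA : ℝ) {δ : ℝ} (hδ : 0 ≤ δ) :
    (noiseCov σU σA δ).PosSemidef := by
  refine Matrix.PosSemidef.of_dotProduct_mulVec_nonneg ?_ fun y => ?_
  · ext i j
    fin_cases i <;> fin_cases j <;> simp [noiseCov]
  · rw [star_trivial, dotProduct_noiseCov]
    have h1 := intervalIntegral.integral_nonneg (μ := volume) hδ
      (f := fun u => (y 1 + y 0 * (δ - u)) ^ 2) fun u _ => sq_nonneg _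
    have h2 := intervalIntegral.integral_nonneg (μ := volume) hδ
      (f := fun u => (y 2 + y 1 * (δ - u) + y 0 * (δ - u) ^ 2 / 2) ^ 2) fun u _ => sq_nonneg _
    positivity

/-- A random vector all of whose linear functionals are centred Gaussian, with variances given by
`S`, is multivariate Gaussian. -/
lemma hasLaw_multivariateGaussian_of_inner {Ω ι : Type*} [Fintype ι] [DecidableEq ι]
    [MeasurableSpace Ω] {P : Measure Ω} [IsProbabilityMeasure P] {X : Ω → EuclideanSpace ℝ ι}
    {S : Matrix ι ι ℝ} (hS : S.PosSemidef)
    (h : ∀ y : EuclideanSpace ℝ ι,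
      HasLaw (fun x => inner ℝ y (X x)) (gaussianReal 0 (y ⬝ᵥ S *ᵥ y).toNNReal) P) :
    HasLaw X (multivariateGaussian 0 S) P := by
  have hX : AEMeasurable X P := by
    have h1 : AEMeasurable (fun x i => X x i) P := aemeasurable_pi_lambda _ fun i => by
      have := (h (EuclideanSpace.single i 1)).aemeasurable
      simpa [EuclideanSpace.inner_single_left] using this
    exact (WithLp.measurable_toLp 2 _).comp_aemeasurable h1
  refine ⟨hX, ?_⟩
  have := Measure.isProbabilityMeasure_map hX
  refine Measure.ext_of_charFun ?_
  ext y
  -- The characteristic function of `X` at `y` is that of `⟨y, X⟩` at `1`.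
  have hy := congrArg (fun μ => charFun μ 1) (h y).map_eq
  simp only [charFun_gaussianReal] at hy
  rw [charFun_apply_real, integral_map (h y).aemeasurable (by fun_prop)] at hy
  rw [charFun_apply, integral_map hX (by fun_prop), charFun_multivariateGaussian hS]
  have hnn : 0 ≤ y ⬝ᵥ S *ᵥ y := by simpa using hS.dotProduct_mulVec_nonneg y.ofLp
  rw [Real.coe_toNNReal _ hnn] at hy
  simp_rw [real_inner_comm y]
  simpa using hy

lemma hasLaw_stateNoise {Ω : Type*} [MeasurableSpace Ω] {P : Measure Ω}
    [IsProbabilityMeasure P] {BU BA : ℝ≥0 → Ω → ℝ} (hU : IsBrownianReal BU P)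
    (hA : IsBrownianReal BA P) (σU σA : ℝ) {δ : ℝ} (hδ : 0 ≤ δ)
    (hi : IndepFun (fun x s => BU s x) (fun x s => BA s x) P) :
    HasLaw (fun x => stateNoise σU σA δ (fun s => BU s x) fun s => BA s x)
      (multivariateGaussian 0 (noiseCov σU σA δ)) P := by
  refine hasLaw_multivariateGaussian_of_inner (posSemidef_noiseCov σU σA hδ) fun y => ?_
  have h1 := hasLaw_wienerIntegral hU hδ (G := fun u => y 1 + y 0 * (δ - u)) (g := fun _ => -y 0)
    (fun u => by
      refine ((((hasDerivAt_id' u).const_sub δ).const_mul (y 0)).const_add (y 1)).congr_deriv ?_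
      ring) continuous_const
  have h2 := hasLaw_wienerIntegral hA hδ
    (G := fun u => y 2 + y 1 * (δ - u) + y 0 * (δ - u) ^ 2 / 2)
    (g := fun u => -y 1 - y 0 * (δ - u))
    (fun u => by
      have hd := (hasDerivAt_id' u).const_sub δ
      refine (((hd.const_mul (y 1)).const_add (y 2)).add
        (((hd.pow 2).const_mul (y 0)).div_const 2)).congr_deriv ?_
      simp; ring) (by fun_prop)
  have h1' := gaussianReal_const_mul h1 σU
  have h2' := gaussianReal_const_mul h2 σA
  obtain ⟨F₀, hF₀, hF₀'⟩ := exists_measurable_integral hδ (h := fun _ => -y 0) continuous_const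
  obtain ⟨F₁, hF₁, hF₁'⟩ := exists_measurable_integral hδ (h := fun u => -y 1 - y 0 * (δ - u))
    (by fun_prop)
  -- Independence passes through measurable maps of the paths, so `F₀` and `F₁` stand in for the
  -- integrals, which they equal on continuous paths.
  have hind := hi.comp
    (φ := fun b => σU * ((y 1 + y 0 * (δ - δ)) * b δ.toNNReal - F₀ b))
    (ψ := fun b => σA * ((y 2 + y 1 * (δ - δ) + y 0 * (δ - δ) ^ 2 / 2) * b δ.toNNReal - F₁ b))
    (by fun_prop) (by fun_prop)
  have hind' := hind.congr
    (f' := fun x => σU * ((y 1 + y 0 * (δ - δ)) * BU δ.toNNReal x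
      - ∫ u in (0 : ℝ)..δ, -y 0 * BU u.toNNReal x))
    (g' := fun x => σA * ((y 2 + y 1 * (δ - δ) + y 0 * (δ - δ) ^ 2 / 2) * BA δ.toNNReal x
      - ∫ u in (0 : ℝ)..δ, (-y 1 - y 0 * (δ - u)) * BA u.toNNReal x))
    (by filter_upwards [hU.cont] with x hx; simp [hF₀' _ hx])
    (by filter_upwards [hA.cont] with x hx; simp [hF₁' _ hx])
  have hsum := gaussianReal_add_gaussianReal_of_indepFun hind' h1'.map_eq h2'.map_eq
  have hlaw : HasLaw _ _ P := ⟨h1'.aemeasurable.add h2'.aemeasurable, hsum⟩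
  have hv : (NNReal.mk (σU ^ 2) (sq_nonneg _) * (∫ u in (0 : ℝ)..δ, (y 1 + y 0 * (δ - u)) ^ 2).toNNReal
      + NNReal.mk (σA ^ 2) (sq_nonneg _) * Real.toNNReal (∫ u in (0 : ℝ)..δ,
        (y 2 + y 1 * (δ - u) + y 0 * (δ - u) ^ 2 / 2) ^ 2) : ℝ≥0)
      = (y.ofLp ⬝ᵥ noiseCov σU σA δ *ᵥ y.ofLp).toNNReal := by
    rw [dotProduct_noiseCov]
    have i1 := intervalIntegral.integral_nonneg (μ := volume) hδ
      (f := fun u => (y 1 + y 0 * (δ - u)) ^ 2) fun u _ => sq_nonneg _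
    have i2 := intervalIntegral.integral_nonneg (μ := volume) hδ
      (f := fun u => (y 2 + y 1 * (δ - u) + y 0 * (δ - u) ^ 2 / 2) ^ 2) fun u _ => sq_nonneg _
    rw [← NNReal.coe_inj, Real.coe_toNNReal _ (by positivity)]
    push_cast
    rw [Real.coe_toNNReal _ i1, Real.coe_toNNReal _ i2]
  rw [hv] at hlaw
  simp only [mul_zero, add_zero] at hlaw
  refine hlaw.congr ?_
  filter_upwards [hA.cont] with x hx
  rw [inner_stateNoise σU σA δ y hx]
  rfl

/-! ### The state equation along a single path. -/

lemma eq_transition_add_stateNoise {T σU σA : ℝ} {u a : ℝ → ℝ} {wU wA : ℝ≥0 → ℝ}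
    (hu : ContDiffOn ℝ 1 u (Icc 0 T)) (hwU : Continuous wU) (hwA : Continuous wA)
    (hsU : ∀ t ∈ Icc 0 T, derivWithin u (Icc 0 T) t =
      derivWithin u (Icc 0 T) 0 + (∫ r in (0 : ℝ)..t, a r) + σU * wU t.toNNReal)
    (hsA : ∀ t ∈ Icc 0 T, a t = a 0 + σA * wA t.toNNReal)
    {s δ : ℝ} (hs : 0 ≤ s) (hδ : 0 ≤ δ) (hsδ : s + δ ≤ T) :
    !₂[u (s + δ), derivWithin u (Icc 0 T) (s + δ), a (s + δ)] =
      WithLp.toLp 2 (transition δ *ᵥ ![u s, derivWithin u (Icc 0 T) s, a s])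
        + stateNoise σU σA δ (fun r => wU (s.toNNReal + r) - wU s.toNNReal)
          (fun r => wA (s.toNNReal + r) - wA s.toNNReal) := by
  set p := derivWithin u (Icc 0 T)
  have hwU' := continuous_comp_toNNReal hwU
  have hwA' := continuous_comp_toNNReal hwA
  -- `a` is controlled only on `[0, T]`; `α` agrees with it there and is continuous on all of `ℝ`,
  -- so its primitive `q` is differentiable everywhere.
  set α : ℝ → ℝ := fun r => a 0 + σA * wA r.toNNReal with hα
  have hαc : Continuous α := by fun_prop
  set q : ℝ → ℝ := fun r => p 0 + ∫ v in (0 : ℝ)..r, α v with hq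
  have hqd : ∀ r, HasDerivAt q (α r) r := fun r =>
    (intervalIntegral.integral_hasDerivAt_right (hαc.intervalIntegrable _ _)
      hαc.stronglyMeasurable.stronglyMeasurableAtFilter hαc.continuousAt).const_add _
  have hqc : Continuous q := continuous_iff_continuousAt.2 fun r => (hqd r).continuousAt
  have hpq : ∀ r ∈ Icc 0 T, p r = q r + σU * wU r.toNNReal := fun r hr => by
    rw [hsU r hr]
    simp only [hq]
    congr 2
    refine intervalIntegral.integral_congr fun v hv => ?_
    rw [uIcc_of_le hr.1] at hv
    exact hsA v ⟨hv.1, hv.2.trans hr.2⟩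
  have hsT : s ∈ Icc 0 T := ⟨hs, by linarith⟩
  have hsδT : s + δ ∈ Icc 0 T := ⟨by linarith, hsδ⟩
  have hadd : ∀ r, 0 ≤ r → (s + r).toNNReal = s.toNNReal + r.toNNReal :=
    fun r hr => Real.toNNReal_add hs hr
  set bU : ℝ≥0 → ℝ := fun r => wU (s.toNNReal + r) - wU s.toNNReal with hbU
  set bA : ℝ≥0 → ℝ := fun r => wA (s.toNNReal + r) - wA s.toNNReal with hbA
  have hbUc : Continuous fun r : ℝ => bU r.toNNReal :=
    continuous_comp_toNNReal (by fun_prop : Continuous bU)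
  have hbAc : Continuous fun r : ℝ => bA r.toNNReal :=
    continuous_comp_toNNReal (by fun_prop : Continuous bA)
  have hαs : ∀ r, 0 ≤ r → α (s + r) = a s + σA * bA r.toNNReal := fun r hr => by
    rw [hsA s hsT]
    simp only [hα, hbA, hadd r hr]
    ring
  have hqδ : q (s + δ) - q s = δ * a s + σA * ∫ r in (0 : ℝ)..δ, bA r.toNNReal := by
    have h := intervalIntegral.integral_eq_sub_of_hasDerivAt (a := s) (b := s + δ)
      (fun r _ => hqd r) (hαc.intervalIntegrable _ _)
    rw [← h, ← intervalIntegral.integral_const_mul]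
    have h2 := intervalIntegral.integral_comp_add_left (a := 0) (b := δ) α s
    rw [add_zero] at h2
    rw [← h2, intervalIntegral.integral_congr (g := fun r => a s + σA * bA r.toNNReal)
      fun r hr => hαs r (by rw [uIcc_of_le hδ] at hr; exact hr.1),
      intervalIntegral.integral_add (continuous_const.intervalIntegrable _ _)
        ((by fun_prop : Continuous fun r : ℝ => σA * bA r.toNNReal).intervalIntegrable _ _)]
    simp
  have hA : a (s + δ) = a s + σA * bA δ.toNNReal := by
    rw [hsA _ hsδT]
    exact hαs δ hδ
  have hP : p (s + δ) = p s + δ * a s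
      + (σU * bU δ.toNNReal + σA * ∫ r in (0 : ℝ)..δ, bA r.toNNReal) := by
    rw [hpq _ hsδT, hpq _ hsT, hadd δ hδ]
    simp only [hbU]
    linarith
  have hI1 : (∫ r in (0 : ℝ)..δ, q (s + r))
      = δ * q s + δ ^ 2 / 2 * a s + σA * ∫ r in (0 : ℝ)..δ, (δ - r) * bA r.toNNReal := by
    -- Integration by parts: this primitive vanishes at `r = δ`, which turns the double integral of
    -- `α` into a single one with weight `δ - r`.
    have hd : ∀ r ∈ uIcc 0 δ, HasDerivAt (fun r => -((δ - r) * q (s + r)))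
        (q (s + r) - (δ - r) * α (s + r)) r := fun r _ => by
      refine ((((hasDerivAt_id' r).const_sub δ).mul ((hqd (s + r)).comp_const_add s r)).neg
        ).congr_deriv ?_
      ring
    have i1 : Continuous fun r => q (s + r) := by fun_prop
    have i2 : Continuous fun r => (δ - r) * α (s + r) := by fun_prop
    have i3 : Continuous fun r => (δ - r) * a s := by fun_prop
    have i4 : Continuous fun r => σA * ((δ - r) * bA r.toNNReal) := by fun_prop
    have h := intervalIntegral.integral_eq_sub_of_hasDerivAt hd ((i1.sub i2).intervalIntegrable _ _)
    rw [intervalIntegral.integral_sub (i1.intervalIntegrable _ _) (i2.intervalIntegrable _ _),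
      intervalIntegral.integral_congr (f := fun r => (δ - r) * α (s + r))
        (g := fun r => (δ - r) * a s + σA * ((δ - r) * bA r.toNNReal)) (fun r hr => by
          rw [uIcc_of_le hδ] at hr
          simp only [hαs r hr.1]
          ring),
      intervalIntegral.integral_add (i3.intervalIntegrable _ _) (i4.intervalIntegrable _ _),
      intervalIntegral.integral_mul_const, intervalIntegral.integral_const_mul,
      intervalIntegral.integral_comp_sub_left (fun w => w), integral_id] at h
    simp only [sub_self, zero_mul, sub_zero, add_zero] at h
    linarith
  have hU : u (s + δ) - u s = δ * p s + δ ^ 2 / 2 * a s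
      + (σU * (∫ r in (0 : ℝ)..δ, bU r.toNNReal)
        + σA * ∫ r in (0 : ℝ)..δ, (δ - r) * bA r.toNNReal) := by
    have hc : Continuous fun r => q r + σU * wU r.toNNReal := by fun_prop
    have hsub : Icc s (s + δ) ⊆ Icc 0 T := Icc_subset_Icc hs hsδ
    -- `derivWithin` is a two-sided derivative only at interior points; continuity suffices at the
    -- ends.
    have h := intervalIntegral.integral_eq_sub_of_hasDerivAt_of_le (f := u)
      (f' := fun r => q r + σU * wU r.toNNReal) (by linarith : s ≤ s + δ)
      (hu.continuousOn.mono hsub) (fun r hr => by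
        have hr' := hsub (Ioo_subset_Icc_self hr)
        rw [← hpq r hr']
        exact ((hu.differentiableOn one_ne_zero) r hr').hasDerivWithinAt.hasDerivAt
          (Icc_mem_nhds (hs.trans_lt hr.1) (hr.2.trans_le hsδ)))
      (hc.intervalIntegrable _ _)
    have h2 := intervalIntegral.integral_comp_add_left (a := 0) (b := δ)
      (fun r => q r + σU * wU r.toNNReal) s
    rw [add_zero] at h2
    have i1 : Continuous fun r => q (s + r) := by fun_prop
    have i2 : Continuous fun r : ℝ => σU * bU r.toNNReal := by fun_prop
    have i3 : Continuous fun r : ℝ => σU * bU r.toNNReal + σU * wU s.toNNReal := by fun_prop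
    rw [← h, ← h2, intervalIntegral.integral_congr
      (g := fun r => q (s + r) + (σU * bU r.toNNReal + σU * wU s.toNNReal)) (fun r hr => by
        rw [uIcc_of_le hδ] at hr
        simp only [hbU, hadd r hr.1]
        ring),
      intervalIntegral.integral_add (i1.intervalIntegrable _ _)
        (i3.intervalIntegrable _ _),
      intervalIntegral.integral_add (i2.intervalIntegrable _ _)
        (continuous_const.intervalIntegrable _ _), hI1, hpq s hsT,
      intervalIntegral.integral_const_mul, intervalIntegral.integral_const]
    simp only [smul_eq_mul, sub_zero]
    ring
  ext i
  fin_cases i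
  · simp [transition, stateNoise]
    linarith
  · simp [transition, stateNoise]
    linarith
  · simp [transition, stateNoise]
    linarith

/-! ### Independence of the past and of later increments. -/

section Independence

variable {Ω : Type*} [MeasurableSpace Ω] {P : Measure Ω} [IsProbabilityMeasure P]
  {E F G : Type*} [MeasurableSpace E] [MeasurableSpace F] [MeasurableSpace G]

/-- The joint law is a triple product measure, which may be reassociated. -/
lemma indepFun_prodMk_right {X : Ω → E} {Y : Ω → F} {Z : Ω → G} (hX : Measurable X)
    (hY : Measurable Y) (hZ : Measurable Z) (h : IndepFun X Y P)
    (h' : IndepFun (fun x => (X x, Y x)) Z P) : IndepFun X (fun x => (Y x, Z x)) P := by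
  have hYZ : IndepFun Y Z P := h'.comp measurable_snd measurable_id
  rw [indepFun_iff_map_prod_eq_prod_map_map (by fun_prop) (by fun_prop)] at h h' hYZ ⊢
  rw [hYZ, ← Measure.prodAssoc_prod, ← h, ← h', Measure.map_map (by fun_prop) (by fun_prop)]
  rfl

lemma indepFun_prodMk_left {X : Ω → E} {Y : Ω → F} {Z : Ω → G} (hX : Measurable X)
    (hY : Measurable Y) (hZ : Measurable Z) (h : IndepFun Y Z P)
    (h' : IndepFun X (fun x => (Y x, Z x)) P) : IndepFun (fun x => (X x, Y x)) Z P := by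
  have h1 := indepFun_prodMk_right hZ hY hX h.symm
    (h'.symm.comp measurable_swap measurable_id)
  exact h1.symm.comp measurable_swap measurable_id

/-- If `X₀`, `X₁`, `X₂`, `X₃` are independent and `X₂`, `X₃` split into independent parts, then
the first parts are independent of `X₀`, `X₁` and the second parts. -/
lemma indepFun_of_iIndep {E₀ E₁ E₂ E₃ S₂ R₂ S₃ R₃ : Type*} [MeasurableSpace E₀]
    [MeasurableSpace E₁] [MeasurableSpace E₂] [MeasurableSpace E₃] [MeasurableSpace S₂]
    [MeasurableSpace R₂] [MeasurableSpace S₃] [MeasurableSpace R₃]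
    {X₀ : Ω → E₀} {X₁ : Ω → E₁} {X₂ : Ω → E₂} {X₃ : Ω → E₃}
    (h₀ : Measurable X₀) (h₁ : Measurable X₁) (h₂ : Measurable X₂) (h₃ : Measurable X₃)
    (h : iIndep ![MeasurableSpace.comap X₀ inferInstance, MeasurableSpace.comap X₁ inferInstance,
      MeasurableSpace.comap X₂ inferInstance, MeasurableSpace.comap X₃ inferInstance] P)
    {f₂ : E₂ → S₂} {g₂ : E₂ → R₂} {f₃ : E₃ → S₃} {g₃ : E₃ → R₃}
    (hf₂ : Measurable f₂) (hg₂ : Measurable g₂) (hf₃ : Measurable f₃) (hg₃ : Measurable g₃)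
    (hi₂ : IndepFun (fun x => f₂ (X₂ x)) (fun x => g₂ (X₂ x)) P)
    (hi₃ : IndepFun (fun x => f₃ (X₃ x)) (fun x => g₃ (X₃ x)) P) :
    IndepFun (fun x => (f₂ (X₂ x), f₃ (X₃ x)))
      (fun x => ((X₀ x, X₁ x), (g₂ (X₂ x), g₃ (X₃ x)))) P := by
  have hle : ∀ i, ![MeasurableSpace.comap X₀ inferInstance, MeasurableSpace.comap X₁ inferInstance,
      MeasurableSpace.comap X₂ inferInstance, MeasurableSpace.comap X₃ inferInstance] i
        ≤ (inferInstance : MeasurableSpace Ω) := by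
    intro i
    fin_cases i
    exacts [h₀.comap_le, h₁.comap_le, h₂.comap_le, h₃.comap_le]
  have k₂ : IndepFun X₂ (fun x => ((X₀ x, X₁ x), X₃ x)) P := by
    have := indep_iSup_of_disjoint hle h (S := {2}) (T := {0, 1, 3}) (by simp)
    rw [IndepFun_iff_Indep]
    refine indep_of_indep_of_le this ?_ ?_
    · exact le_iSup₂_of_le (2 : Fin 4) rfl le_rfl
    · refine ((Measurable.prodMk (.prodMk ?_ ?_) ?_)).comap_le
      · exact measurable_iff_comap_le.2 (le_iSup₂_of_le (0 : Fin 4) (by simp) le_rfl)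
      · exact measurable_iff_comap_le.2 (le_iSup₂_of_le (1 : Fin 4) (by simp) le_rfl)
      · exact measurable_iff_comap_le.2 (le_iSup₂_of_le (3 : Fin 4) (by simp) le_rfl)
  have k₃ : IndepFun X₃ (fun x => ((X₀ x, X₁ x), X₂ x)) P := by
    have := indep_iSup_of_disjoint hle h (S := {3}) (T := {0, 1, 2}) (by simp)
    rw [IndepFun_iff_Indep]
    refine indep_of_indep_of_le this ?_ ?_
    · exact le_iSup₂_of_le (3 : Fin 4) rfl le_rfl
    · refine ((Measurable.prodMk (.prodMk ?_ ?_) ?_)).comap_le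
      · exact measurable_iff_comap_le.2 (le_iSup₂_of_le (0 : Fin 4) (by simp) le_rfl)
      · exact measurable_iff_comap_le.2 (le_iSup₂_of_le (1 : Fin 4) (by simp) le_rfl)
      · exact measurable_iff_comap_le.2 (le_iSup₂_of_le (2 : Fin 4) (by simp) le_rfl)
  have m₂ := hf₂.comp h₂
  have m₃ := hf₃.comp h₃
  have n₂ := hg₂.comp h₂
  have n₃ := hg₃.comp h₃
  have a₂ := indepFun_prodMk_right m₂ n₂ (by fun_prop) hi₂
    (k₂.comp (φ := fun e => (f₂ e, g₂ e)) (by fun_prop) measurable_id)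
  have a₃ := indepFun_prodMk_right m₃ n₃ (by fun_prop) hi₃
    (k₃.comp (φ := fun e => (f₃ e, g₃ e)) (ψ := fun e => (e.1, g₂ e.2)) (by fun_prop)
      (by fun_prop))
  -- With `R` the target right-hand side, it suffices that `f₃ ∘ X₃` is independent of `R` and `f₂ ∘
  -- X₂` of `(f₃ ∘ X₃, R)`.
  refine indepFun_prodMk_left m₂ m₃ (by fun_prop) ?_ ?_
  · exact a₃.comp (ψ := fun e => (e.2.1, (e.2.2, e.1))) measurable_id (by fun_prop)
  · exact a₂.comp (ψ := fun e => (f₃ e.2.2, (e.2.1, (e.1, g₃ e.2.2)))) measurable_id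
      (by fun_prop)

end Independence

/-- Independence only compares measures of preimages, and completion gives every set the same
measure. -/
lemma indepFun_completion_iff {Ω E F : Type*} [MeasurableSpace Ω] {P : Measure Ω}
    [MeasurableSpace E] [MeasurableSpace F] {X : Ω → E} {Y : Ω → F} :
    IndepFun (_mΩ := (inferInstance : MeasurableSpace (NullMeasurableSpace Ω P))) X Y P.completion
      ↔ IndepFun X Y P :=
  (IndepFun_iff (Ω := NullMeasurableSpace Ω P) X Y P.completion).trans (IndepFun_iff X Y P).symm

lemma iIndep_completion_iff {Ω ι : Type*} [MeasurableSpace Ω] {P : Measure Ω}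
    {m : ι → MeasurableSpace Ω} :
    iIndep (_mΩ := (inferInstance : MeasurableSpace (NullMeasurableSpace Ω P))) m P.completion
      ↔ iIndep m P :=
  (iIndep_iff (Ω := NullMeasurableSpace Ω P) m P.completion).trans (iIndep_iff m P).symm

/-! ### States of the nested process and the final assembly. -/

lemma state_zero {Ω : Type*} [MeasurableSpace Ω] {T : ℝ} {U A : ℝ → Ω → ℝ} (x : Ω) : (state T U A 0 x).ofLp =
    ![initialValues 2 T U x 0, initialValues 2 T U x 1, initialValues 1 T A x 0] := by
  ext i
  fin_cases i <;> simp [state, initialValues, iteratedDerivWithin_one]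

variable {Ω : Type*} [MeasurableSpace Ω] {P : Measure Ω} {T σU σA σμ σα : ℝ}
  {U A : ℝ → Ω → ℝ} {WU WA : ℝ≥0 → Ω → ℝ}

/-- One null set serves all `s` and `δ`. -/
lemma IsNestedGP.state_add (h : IsNestedGP 2 1 T σU σA σμ σα U A WU WA P) :
    ∀ᵐ x ∂P, Continuous (fun r => WU r x) ∧ Continuous (fun r => WA r x) ∧
      ∀ s δ, 0 ≤ s → 0 ≤ δ → s + δ ≤ T →
        state T U A (s + δ) x =
          WithLp.toLp 2 (transition δ *ᵥ (state T U A s x).ofLp)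
            + stateNoise σU σA δ (fun r => WU (s.toNNReal + r) x - WU s.toNNReal x)
              (fun r => WA (s.toNNReal + r) x - WA s.toNNReal x) := by
  filter_upwards [h.brownian_U.cont, h.brownian_A.cont, h.smooth_U, h.sde_U, h.sde_A]
    with x hU hA hs hsU hsA
  simp only [Nat.add_one_sub_one, tsub_self, iteratedDerivWithin_one, iteratedDerivWithin_zero,
    Nat.cast_one] at hs hsU hsA
  exact ⟨hU, hA, fun s δ h0 hδ hT => eq_transition_add_stateNoise hs hU hA hsU hsA h0 hδ hT⟩

/-- If `X`, `Y` and two Brownian motions are independent, then the increments of the Brownian motions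
after time `s` are independent of `X`, `Y` and of the Brownian motions up to time `s`. -/
lemma indepFun_shift_of_iIndep [IsProbabilityMeasure P] {E F : Type*} [MeasurableSpace E]
    [MeasurableSpace F] {X : Ω → E} {Y : Ω → F} (hX : AEMeasurable X P) (hY : AEMeasurable Y P)
    (hU : IsBrownianReal WU P) (hA : IsBrownianReal WA P)
    (h : iIndep ![MeasurableSpace.comap X inferInstance, MeasurableSpace.comap Y inferInstance,
      MeasurableSpace.comap (fun x (r : ℝ≥0) => WU r x) inferInstance,
      MeasurableSpace.comap (fun x (r : ℝ≥0) => WA r x) inferInstance] P) (s : ℝ≥0) :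
    IndepFun
      (fun x => ((fun r : ℝ≥0 => WU (s + r) x - WU s x), fun r : ℝ≥0 => WA (s + r) x - WA s x))
      (fun x => ((X x, Y x), ((fun r : Iic s => WU r x), fun r : Iic s => WA r x))) P := by
  -- Each coordinate of a path is only a.e. measurable, and uncountably many null sets cannot be
  -- discarded together; under the completion the whole path map is measurable.
  have hprob : IsProbabilityMeasure P.completion := ⟨measure_univ (μ := P)⟩
  have path : ∀ {W : ℝ≥0 → Ω → ℝ}, IsBrownianReal W P →
      Measurable (fun (x : NullMeasurableSpace Ω P) (r : ℝ≥0) => W r x) := fun hW =>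
    measurable_pi_lambda _ fun r => (hW.aemeasurable r).nullMeasurable.measurable'
  have hshift : Measurable fun (w : ℝ≥0 → ℝ) (r : ℝ≥0) => w (s + r) - w s := by fun_prop
  have hpast : Measurable fun (w : ℝ≥0 → ℝ) (r : Iic s) => w r := by fun_prop
  have hX' : Measurable (α := NullMeasurableSpace Ω P) X := hX.nullMeasurable.measurable'
  have hY' : Measurable (α := NullMeasurableSpace Ω P) Y := hY.nullMeasurable.measurable'
  have h' := iIndep_completion_iff.2 h
  have hU' := indepFun_completion_iff.2 (hU.indepFun_shift s)
  have hA' := indepFun_completion_iff.2 (hA.indepFun_shift s)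
  exact indepFun_completion_iff.1 <| indepFun_of_iIndep (Ω := NullMeasurableSpace Ω P)
    (P := P.completion) hX' hY' (path hU) (path hA) h' hshift hpast hshift hpast hU' hA'

/-- The state at a time `t ≤ s` is a measurable function of the initial values and of the driving
processes up to time `s`. -/
lemma IsNestedGP.exists_measurable_state (h : IsNestedGP 2 1 T σU σA σμ σα U A WU WA P)
    {s t : ℝ} (ht : 0 ≤ t) (hts : t ≤ s) (htT : t ≤ T) :
    ∃ H : (EuclideanSpace ℝ (Fin 2) × EuclideanSpace ℝ (Fin 1)) ×
        ((Iic s.toNNReal → ℝ) × (Iic s.toNNReal → ℝ)) → EuclideanSpace ℝ (Fin 3),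
      Measurable H ∧ ∀ᵐ x ∂P, H ((initialValues 2 T U x, initialValues 1 T A x),
        ((fun r : Iic s.toNNReal => WU r x), fun r : Iic s.toNNReal => WA r x))
          = state T U A t x := by
  obtain ⟨F, hF, hF'⟩ := exists_measurable_stateNoise σU σA ht
  -- The path stopped at `s` and recentred at its initial value: it reads only times up to `s`, and
  -- stays continuous if the path is.
  let cut (w : Iic s.toNNReal → ℝ) (r : ℝ≥0) : ℝ :=
    w ⟨min r s.toNNReal, mem_Iic.2 (min_le_right _ _)⟩ - w ⟨0, mem_Iic.2 zero_le⟩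
  have hcut : Measurable cut := by unfold cut; fun_prop
  have hcont : ∀ {w : ℝ≥0 → ℝ}, Continuous w → Continuous (cut fun r => w r) := fun hw => by
    simp only [cut]; fun_prop
  have hagree : ∀ w : ℝ≥0 → ℝ, ∀ r ≤ t.toNNReal,
      w (Real.toNNReal 0 + r) - w (Real.toNNReal 0) = cut (fun r => w r) r := fun w r hr => by
    simp [cut, min_eq_left (hr.trans (Real.toNNReal_le_toNNReal hts))]
  refine ⟨fun e => WithLp.toLp 2 (transition t *ᵥ ![e.1.1 0, e.1.1 1, e.1.2 0])
    + F (cut e.2.1, cut e.2.2), ?_, ?_⟩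
  · have hvec : Measurable fun e : (EuclideanSpace ℝ (Fin 2) × EuclideanSpace ℝ (Fin 1)) ×
        ((Iic s.toNNReal → ℝ) × (Iic s.toNNReal → ℝ)) =>
        (![e.1.1 0, e.1.1 1, e.1.2 0] : Fin 3 → ℝ) :=
      measurable_pi_lambda _ fun i => by fin_cases i <;> simp <;> fun_prop
    have hmul : Measurable fun v : Fin 3 → ℝ => WithLp.toLp 2 (transition t *ᵥ v) :=
      (WithLp.measurable_toLp 2 _).comp
        (Continuous.matrix_mulVec continuous_const continuous_id).measurable
    exact (hmul.comp hvec).add (hF.comp (by fun_prop))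
  · filter_upwards [h.state_add] with x hx
    obtain ⟨hU, hA, hadd⟩ := hx
    -- The state at `t` is reached in one step from time `0`.
    have := hadd 0 t le_rfl ht (by simpa using htT)
    rw [zero_add, state_zero, stateNoise_congr ht (hagree fun r => WU r x)
      (hagree fun r => WA r x)] at this
    rw [this, hF' _ _ (hcont hU) (hcont hA)]

end NestedGP

end

theorem proposition1 {Ω : Type*} [MeasurableSpace Ω] (P : Measure Ω) [IsProbabilityMeasure P]
    (T σU σA σμ σα : ℝ) (hσU : 0 < σU) (hσA : 0 < σA)
    (U A : ℝ → Ω → ℝ) (WU WA : ℝ≥0 → Ω → ℝ)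
    (hUA : NestedGP.IsNestedGP 2 1 T σU σA σμ σα U A WU WA P)
    (J : ℕ) (t : Fin (J + 1) → ℝ) (ht : StrictMono t) (ht0 : t 0 = 0) (htT : ∀ j, t j < T) :
    ∃ ω : Fin J → Ω → EuclideanSpace ℝ (Fin 3), ∀ j : Fin J,
      (∀ x, NestedGP.state T U A (t j.succ) x =
        WithLp.toLp 2 (NestedGP.transition (t j.succ - t j.castSucc) *ᵥ
          (NestedGP.state T U A (t j.castSucc) x).ofLp) + ω j x) ∧
      (NestedGP.noiseCov σU σA (t j.succ - t j.castSucc)).PosSemidef ∧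
      HasLaw (ω j)
        (multivariateGaussian 0 (NestedGP.noiseCov σU σA (t j.succ - t j.castSucc))) P ∧
      IndepFun (ω j)
        (fun x (i : Set.Iic j.castSucc) => NestedGP.state T U A (t i) x) P := by
  -- Taking `ω j` as the residual makes the state equation hold at every `x`; it equals `stateNoise`
  -- only almost surely.
  refine ⟨fun j x => NestedGP.state T U A (t j.succ) x -
    WithLp.toLp 2 (NestedGP.transition (t j.succ - t j.castSucc) *ᵥ
      (NestedGP.state T U A (t j.castSucc) x).ofLp), fun j => ?_⟩
  have hnn : ∀ i, 0 ≤ t i := fun i => ht0 ▸ ht.monotone (Fin.zero_le i)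
  set s := t j.castSucc with hs
  have hδ : 0 ≤ t j.succ - s := sub_nonneg.2 (ht.monotone (Fin.castSucc_le_succ j))
  set δ := t j.succ - s with hδ'
  have hω : ∀ᵐ x ∂P,
      NestedGP.stateNoise σU σA δ (fun r => WU (s.toNNReal + r) x - WU s.toNNReal x)
        (fun r => WA (s.toNNReal + r) x - WA s.toNNReal x)
      = NestedGP.state T U A (t j.succ) x -
        WithLp.toLp 2 (NestedGP.transition δ *ᵥ (NestedGP.state T U A s x).ofLp) := by
    filter_upwards [hUA.state_add] with x hx
    have := hx.2.2 s δ (hnn _) hδ (by rw [hδ', add_sub_cancel]; exact (htT _).le)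
    rw [hδ', add_sub_cancel, ← hδ'] at this
    rw [this, add_sub_cancel_left]
  have hind := NestedGP.indepFun_shift_of_iIndep hUA.law_μ.aemeasurable hUA.law_α.aemeasurable
    hUA.brownian_U hUA.brownian_A hUA.indep s.toNNReal
  refine ⟨fun x => (add_sub_cancel _ _).symm, NestedGP.posSemidef_noiseCov σU σA hδ, ?_, ?_⟩
  · have hpaths : IndepFun (fun x r => WU r x) (fun x r => WA r x) P :=
      (IndepFun_iff_Indep _ _ _).2 (hUA.indep.indep (i := 2) (j := 3) (by decide))
    have hshift : Measurable fun (w : ℝ≥0 → ℝ) (r : ℝ≥0) =>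
      w (s.toNNReal + r) - w s.toNNReal := by fun_prop
    exact (NestedGP.hasLaw_stateNoise (hUA.brownian_U.shift s.toNNReal)
      (hUA.brownian_A.shift s.toNNReal) σU σA hδ (hpaths.comp hshift hshift)).congr
        (hω.mono fun x hx => hx.symm)
  · obtain ⟨F, hF, hF'⟩ := NestedGP.exists_measurable_stateNoise σU σA hδ
    have hst : ∀ i : Set.Iic j.castSucc, t i ≤ s := fun i => ht.monotone i.2
    choose H hH hH' using fun i : Set.Iic j.castSucc =>
      hUA.exists_measurable_state (hnn i) (hst i) (htT i).le
    refine (hind.comp hF (measurable_pi_lambda (fun e i => H i e) hH)).congr ?_ ?_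
    · filter_upwards [hω, hUA.state_add] with x hx hc
      rw [← hx]
      exact hF' _ _ ((hc.1.comp (continuous_const.add continuous_id)).sub continuous_const)
        ((hc.2.1.comp (continuous_const.add continuous_id)).sub continuous_const)
    · filter_upwards [ae_all_iff.2 hH'] with x hx
      exact funext hx
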